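/- A tree-like tableau of size $m$ is a Ferrers diagram whose number of rows plus number of columns equals $m+1$, in which some cells are pointed, such that: (1) the cell in the first row and first column is pointed (the root point); (2) every row and every column contains at least one pointed cell; (3) for every pointed cell other than the root there is a pointed cell above it in the same column or a pointed cell to its left in the same row, but not both. It is symmetric if its diagram and its set of pointed cells are invariant under reflection in the main diagonal. A diagonal box is a cell of the diagram (pointed or not) lying in row $i$ and column $i$ for some $i$. For $n\ge 0$ let $D_n$ be the number of diagonal boxes in a uniformly random symmetric tree-like tableau of size $2n+1$. Then, as $n\to\infty$, $$\frac{D_n-3(n+1)/4}{\sqrt{7(n+1)/48}}\ \xrightarrow{\ d\ }\ N(0,1).$$ -/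

import Mathlib

open MeasureTheory ProbabilityTheory Filter

/-- A tree-like tableau of size `n`: a Ferrers diagram of half-perimeter `n + 1`, some of whose
cells are pointed. A cell `(i, j)` is in row `i` and column `j`, both counted from `0`, so that
`shape.colLen 0` is the number of rows and `shape.rowLen 0` the number of columns. -/
structure TreeLikeTableau (n : ℕ) where
  /-- The underlying Ferrers diagram. -/
  shape : YoungDiagram
  /-- The set of pointed cells. -/
  points : Finset (ℕ × ℕ)
  points_subset : points ⊆ shape.cells
  halfPerimeter_eq : shape.colLen 0 + shape.rowLen 0 = n + 1
  /-- The top left cell is pointed (the root point). -/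
  root_mem : (0, 0) ∈ points
  /-- Every row contains a pointed cell. -/
  exists_point_row : ∀ i < shape.colLen 0, ∃ j, (i, j) ∈ points
  /-- Every column contains a pointed cell. -/
  exists_point_col : ∀ j < shape.rowLen 0, ∃ i, (i, j) ∈ points
  /-- Every non-root point has a point above it in its column or to its left in its row,
  but not both. -/
  above_xor_left : ∀ i j, (i, j) ∈ points → (i, j) ≠ (0, 0) →
    Xor (∃ i' < i, (i', j) ∈ points) (∃ j' < j, (i, j') ∈ points)

namespace TreeLikeTableau

/-- A tableau is symmetric if the reflection in the main diagonal preserves its shape and its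
set of points. -/
def IsSymmetric {n : ℕ} (T : TreeLikeTableau n) : Prop :=
  T.shape.transpose = T.shape ∧ ∀ i j, (i, j) ∈ T.points ↔ (j, i) ∈ T.points

/-- The number of diagonal boxes, i.e. of cells `(i, i)` of the diagram, pointed or not. -/
def numDiagonalBoxes {n : ℕ} (T : TreeLikeTableau n) : ℕ :=
  (T.shape.cells.filter fun c => c.1 = c.2).card

theorem cells_subset {n : ℕ} (T : TreeLikeTableau n) :
    T.shape.cells ⊆ Finset.range (n + 2) ×ˢ Finset.range (n + 2) := by
  rintro ⟨i, j⟩ h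
  have h' : (i, j) ∈ T.shape := h
  have h1 : (i, 0) ∈ T.shape := T.shape.up_left_mem le_rfl (Nat.zero_le _) h'
  have h2 : (0, j) ∈ T.shape := T.shape.up_left_mem (Nat.zero_le _) le_rfl h'
  rw [YoungDiagram.mem_iff_lt_colLen] at h1
  rw [YoungDiagram.mem_iff_lt_rowLen] at h2
  have := T.halfPerimeter_eq
  simp only [Finset.mem_product, Finset.mem_range]
  omega

instance instFinite (n : ℕ) : Finite (TreeLikeTableau n) := by
  let s := (Finset.range (n + 2) ×ˢ Finset.range (n + 2)).powerset
  let f : TreeLikeTableau n → s × s := fun T =>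
    (⟨T.shape.cells, Finset.mem_powerset.2 T.cells_subset⟩,
      ⟨T.points, Finset.mem_powerset.2 (T.points_subset.trans T.cells_subset)⟩)
  refine Finite.of_injective f ?_
  intro T U h
  have h1 : T.shape.cells = U.shape.cells := congrArg (fun p => (p.1 : Finset (ℕ × ℕ))) h
  have h2 : T.points = U.points := congrArg (fun p => (p.2 : Finset (ℕ × ℕ))) h
  have h3 : T.shape = U.shape := YoungDiagram.ext h1
  cases T
  cases U
  simp_all

end TreeLikeTableau

/-- Symmetric tree-like tableaux of size `n`. -/
abbrev SymmetricTreeLikeTableau (n : ℕ) : Type :=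
  {T : TreeLikeTableau n // T.IsSymmetric}

namespace SymmetricTreeLikeTableau

/-- Every set of tableaux is an event. -/
instance instMeasurableSpace (n : ℕ) : MeasurableSpace (SymmetricTreeLikeTableau n) := ⊤

/-- The hook with `n + 1` rows and `n + 1` columns. -/
def hookShape (n : ℕ) : YoungDiagram where
  cells := (Finset.range (n + 1) ×ˢ Finset.range (n + 1)).filter fun c => c.1 = 0 ∨ c.2 = 0
  isLowerSet := by
    rintro ⟨a, b⟩ ⟨c, d⟩ ⟨h1, h2⟩ h
    simp at h h1 h2 ⊢
    omega

theorem mem_hookShape {n i j : ℕ} :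
    (i, j) ∈ hookShape n ↔ (i ≤ n ∧ j ≤ n) ∧ (i = 0 ∨ j = 0) := by
  rw [← YoungDiagram.mem_cells]
  simp [hookShape]

theorem hookShape_colLen (n : ℕ) : (hookShape n).colLen 0 = n + 1 := by
  have h (i : ℕ) : i < (hookShape n).colLen 0 ↔ i ≤ n := by
    rw [← YoungDiagram.mem_iff_lt_colLen, mem_hookShape]
    simp
  have h1 := h n
  have h2 := h (n + 1)
  omega

theorem hookShape_rowLen (n : ℕ) : (hookShape n).rowLen 0 = n + 1 := by
  have h (j : ℕ) : j < (hookShape n).rowLen 0 ↔ j ≤ n := by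
    rw [← YoungDiagram.mem_iff_lt_rowLen, mem_hookShape]
    simp
  have h1 := h n
  have h2 := h (n + 1)
  omega

instance instNonempty (n : ℕ) : Nonempty (SymmetricTreeLikeTableau (2 * n + 1)) := by
  refine ⟨⟨⟨hookShape n, (hookShape n).cells, subset_rfl, ?_, ?_, ?_, ?_, ?_⟩, ?_, ?_⟩⟩
  · rw [hookShape_colLen, hookShape_rowLen]
    omega
  · simp [mem_hookShape]
  · intro i hi
    rw [hookShape_colLen] at hi
    refine ⟨0, ?_⟩
    simp [mem_hookShape]
    omega
  · intro j hj
    rw [hookShape_rowLen] at hj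
    refine ⟨0, ?_⟩
    simp [mem_hookShape]
    omega
  · intro i j hij h0
    simp only [YoungDiagram.mem_cells, mem_hookShape] at hij ⊢
    rcases hij with ⟨⟨hi, hj⟩, rfl | rfl⟩
    · have hj0 : 0 < j := Nat.pos_of_ne_zero fun h => h0 (by rw [h])
      exact Or.inr ⟨⟨0, hj0, by simp⟩, by rintro ⟨k, hk, -⟩; omega⟩
    · have hi0 : 0 < i := Nat.pos_of_ne_zero fun h => h0 (by rw [h])
      exact Or.inl ⟨⟨0, hi0, by simp⟩, by rintro ⟨k, hk, -⟩; omega⟩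
  · ext ⟨i, j⟩
    simp only [YoungDiagram.mem_cells, YoungDiagram.mem_transpose, Prod.swap_prod_mk,
      mem_hookShape]
    tauto
  · intro i j
    simp only [YoungDiagram.mem_cells, mem_hookShape]
    tauto

end SymmetricTreeLikeTableau

/-!
Index the rows and the columns of a symmetric tableau of size `2 * n + 1` by `0, …, n`, and let
`m k` be the column of the leftmost point of row `k`. By symmetry, the third condition on the points
says that every point other than the root is the leftmost point of exactly one of its row and of the
row of its mirror image. Hence the points are the pairs `(k, m k)` and their mirror images, and a
map `m` comes from a tableau if and only if `m 0 = 0`, the pairs `(k, m k)` lie in the diagram, and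
`m (m k) < k` for `k ≠ 0` (`parentMaps`, `tableauOfFilling_injective`, `exists_tableauOfFilling`).

The diagram is given by the half of its border going from the bottom left corner to the main
diagonal, a word whose horizontal steps count the diagonal boxes (`borderDiagram`,
`card_diagonal_borderDiagram`). The number `G` of fillings satisfies
`G (u E N v) = G (u N E v) + G (u E v) + G (u N v)`, as a pointed corner is the only point of its
row or of its column (`ncard_parentMaps_corner`), with boundary relations `G (N v) = G v` and
`G (u N) = G (u E)`. These relations determine `G`, and a solution on the states `k = 1, 2, …` is
`wordValue`: `N` multiplies the state `k` by `k`, and `E` sends it to the state `k + 1` minus `k`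
times itself (`ncard_parentMaps_diagramRel`).

Summing over the words gives a recurrence in `n` and in the state, satisfied as well by power series
in `w = (1 + x) / (2 * x)`. Therefore the generating polynomial of the number of diagonal boxes is
`(x - 1) ^ (n + 1) / 2 * ∑ j, j ^ n * w ^ j` (`hasSum_pow_mul_choose`). At `x = exp (2 * φ * I)`,
Lipschitz's formula turns this into a sum of `(n + 1)`-st powers over the logarithms of `w`
(`wordSum_eq_tsum_poleTerm`). The principal logarithm dominates (`norm_tsum_poleTerm_sub_le`), and
its term is `(1 - 7 / 24 * φ ^ 2 + o(φ ^ 2)) ^ (n + 1)` after centring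
(`tendsto_poleTerm_zero_sub_one`). With `φ` of order `(n + 1) ^ (-1 / 2)`, this converges to the
characteristic function of the Gaussian law, and Lévy's theorem concludes.
-/

/-! ### Parent maps -/

/-- The maps `m : V → {0} ∪ V`, extended by `0` outside `V`, such that every `k ∈ V` is either sent
to the root `0` or related by `R` to its image, and such that `m (m k) < k`. For `0 ∉ V`, these
encode the symmetric fillings of a symmetric diagram: `m k` is the column of the leftmost point of
row `k`. -/
def parentMaps (V : Finset ℕ) (R : ℕ → ℕ → Prop) : Set (ℕ → ℕ) :=
  {m | (∀ k ∉ V, m k = 0) ∧ ∀ k ∈ V, (m k = 0 ∨ m k ∈ V ∧ R k (m k)) ∧ m (m k) < k}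

theorem finite_parentMaps (V : Finset ℕ) (R : ℕ → ℕ → Prop) : (parentMaps V R).Finite := by
  have : Finite (parentMaps V R) := by
    refine Finite.of_injective
      (fun m (k : V) => (⟨m.1 k, ?_⟩ : (insert 0 V : Finset ℕ))) ?_
    · rcases (m.2.2 k k.2).1 with h | h
      · simp [h]
      · simp [h.1]
    · intro m m' h
      ext k
      by_cases hk : k ∈ V
      · have := congrFun h ⟨k, hk⟩
        simpa using this
      · rw [m.2.1 k hk, m'.2.1 k hk]
  exact Set.toFinite _

theorem parentMaps_congr {V : Finset ℕ} {R R' : ℕ → ℕ → Prop}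
    (h : ∀ i ∈ V, ∀ j ∈ V, i ≠ j → (R i j ↔ R' i j)) : parentMaps V R = parentMaps V R' := by
  ext m
  refine and_congr_right fun _ => forall₂_congr fun k hk => ?_
  -- A fixed point `m k = k` would contradict `m (m k) < k`.
  by_cases hm : m k = k
  · simp [hm]
  · by_cases hmV : m k ∈ V
    · rw [h k hk _ hmV (Ne.symm hm)]
    · simp [hmV]

/-- If `(a, b)` is a corner of the diagram, then the parent maps sending `a` to `b` have no
preimage of `a`, so that `a` can be removed. -/
theorem ncard_parentMaps_leaf {V : Finset ℕ} {R : ℕ → ℕ → Prop} {a b : ℕ} (h0 : 0 ∉ V)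
    (ha : a ∈ V) (hb : b ∈ V) (hab : a ≠ b) (hR : R a b) (h1 : ∀ k, R k a → k ≤ b)
    (h2 : ∀ k, R b k → k ≤ a) :
    {m ∈ parentMaps V R | m a = b}.ncard = (parentMaps (V.erase a) R).ncard := by
  have ha0 : a ≠ 0 := fun h => h0 (h ▸ ha)
  have hb0 : b ≠ 0 := fun h => h0 (h ▸ hb)
  -- A preimage `k` of `a` satisfies `k ≤ b` as `(a, b)` is a corner, and `b = m (m k) < k`.
  have key : ∀ m ∈ parentMaps V R, m a = b → ∀ k ∈ V, m k ≠ a := by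
    rintro m hm hmab k hk hka
    obtain ⟨h3, h4⟩ := hm.2 k hk
    rw [hka] at h3 h4
    rw [hmab] at h4
    rcases h3 with h3 | h3
    · exact ha0 h3
    · exact absurd (h1 k h3.2) (by omega)
  refine Set.ncard_congr (fun m _ => Function.update m a 0) ?_ ?_ ?_
  · rintro m ⟨hm, hmab⟩
    refine ⟨fun k hk => ?_, fun k hk => ?_⟩
    · rw [Finset.mem_erase, not_and_or, not_not] at hk
      rcases eq_or_ne k a with rfl | h
      · simp
      · rw [Function.update_of_ne h]
        exact hm.1 k (by tauto)
    · rw [Finset.mem_erase] at hk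
      have hka := key m hm hmab k hk.2
      have := hm.2 k hk.2
      rw [Function.update_of_ne hk.1, Function.update_of_ne hka, Finset.mem_erase]
      tauto
  · rintro m m' ⟨hm, hmab⟩ ⟨hm', hmab'⟩ h
    ext k
    rcases eq_or_ne k a with rfl | hk
    · rw [hmab, hmab']
    · simpa [Function.update_of_ne hk] using congrFun h k
  · intro m hm
    have hma : m a = 0 := hm.1 a (by simp)
    have hne : ∀ k, m k ≠ a := by
      intro k hk
      by_cases hkV : k ∈ V.erase a
      · have := (hm.2 k hkV).1
        rw [hk] at this
        simp [ha0] at this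
      · exact ha0 (hk ▸ hm.1 k hkV)
    refine ⟨Function.update m a b, ⟨⟨fun k hk => ?_, fun k hk => ?_⟩, by simp⟩, ?_⟩
    · have hka : k ≠ a := fun h => hk (h ▸ ha)
      rw [Function.update_of_ne hka]
      exact hm.1 k (by simp [hk])
    · rcases eq_or_ne k a with rfl | hka
      · rw [Function.update_self, Function.update_of_ne hab.symm]
        refine ⟨Or.inr ⟨hb, hR⟩, ?_⟩
        rcases (hm.2 b (by simp [hb, hab.symm])).1 with h | h
        · omega
        · have := h2 _ h.2
          have := hne b
          omega
      · have := hm.2 k (by simp [hka, hk])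
        rw [Function.update_of_ne hka, Function.update_of_ne (hne k)]
        simp only [Finset.mem_erase] at this
        tauto
    · simp [← hma]

/-- Removing a corner: either the corner is not pointed, or its row or its column contains no other
point and can be deleted. -/
theorem ncard_parentMaps_corner {V : Finset ℕ} {R R' : ℕ → ℕ → Prop} {a b : ℕ} (h0 : 0 ∉ V)
    (ha : a ∈ V) (hb : b ∈ V) (hab : a ≠ b) (hsymm : ∀ i j, R i j → R j i)
    (h1 : ∀ k, R k a → k ≤ b) (h2 : ∀ k, R b k → k ≤ a)
    (hR : ∀ i j, R i j ↔ R' i j ∨ i = a ∧ j = b ∨ i = b ∧ j = a) (hR' : ¬R' a b)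
    (hR'' : ¬R' b a) :
    (parentMaps V R).ncard = (parentMaps V R').ncard + (parentMaps (V.erase a) R).ncard +
      (parentMaps (V.erase b) R).ncard := by
  have hb0 : b ≠ 0 := fun h => h0 (h ▸ hb)
  have ha0 : a ≠ 0 := fun h => h0 (h ▸ ha)
  have hRab : R a b := (hR a b).2 (by simp)
  have fin (p : (ℕ → ℕ) → Prop) : {m ∈ parentMaps V R | p m}.Finite :=
    (finite_parentMaps _ _).subset (Set.sep_subset _ _)
  rw [← ncard_parentMaps_leaf h0 ha hb hab hRab h1 h2,
    ← ncard_parentMaps_leaf h0 hb ha hab.symm (hsymm _ _ hRab) (fun k hk => h2 k (hsymm _ _ hk))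
      (fun k hk => h1 k (hsymm _ _ hk)), ← Set.ncard_union_eq ?_ (finite_parentMaps _ _) (fin _),
    ← Set.ncard_union_eq ?_ ((finite_parentMaps _ _).union (fin _)) (fin _)]
  · congr 1
    ext m
    simp only [Set.mem_union, Set.mem_sep_iff]
    constructor
    · intro hm
      by_cases h3 : m a = b
      · tauto
      by_cases h4 : m b = a
      · tauto
      refine Or.inl (Or.inl ⟨hm.1, fun k hk => ?_⟩)
      have := hm.2 k hk
      rw [hR] at this
      rcases this with ⟨h5 | ⟨h5, h6 | h6 | h6⟩, h7⟩
      · tauto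
      · tauto
      · exact absurd (h6.1 ▸ h6.2) h3
      · exact absurd (h6.1 ▸ h6.2) h4
    · rintro ((hm | hm) | hm)
      · refine ⟨hm.1, fun k hk => ?_⟩
        rw [hR]
        have := hm.2 k hk
        tauto
      · exact hm.1
      · exact hm.1
  · refine Set.disjoint_left.2 fun m hm hm' => ?_
    rcases hm with hm | hm
    · rcases (hm.2 b hb).1 with h | h
      · exact ha0 (hm'.2.symm.trans h)
      · exact hR'' (hm'.2 ▸ h.2)
    · have := (hm.1.2 a ha).2
      rw [hm.2, hm'.2] at this
      exact lt_irrefl _ this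
  · refine Set.disjoint_left.2 fun m hm hm' => ?_
    rcases (hm.2 a ha).1 with h | h
    · exact hb0 (hm'.2.symm.trans h)
    · exact hR' (hm'.2 ▸ h.2)

/-! ### Border words -/

/-- The set of labels of a labelled word. -/
def labels (L : List (ℕ × Bool)) : Finset ℕ := (L.map Prod.fst).toFinset

@[simp] theorem labels_nil : labels [] = ∅ := rfl

@[simp] theorem labels_cons (p : ℕ × Bool) (L : List (ℕ × Bool)) :
    labels (p :: L) = insert p.1 (labels L) := by simp [labels]

@[simp] theorem labels_append (L L' : List (ℕ × Bool)) :
    labels (L ++ L') = labels L ∪ labels L' := by simp [labels]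

/-- The symmetric diagram whose border, read from the bottom left corner to the main diagonal, is
the labelled word `L`. The letter `(a, true)` is the horizontal step below column `a`, and the
letter `(a, false)` is the vertical step at the end of row `a`. By symmetry, a row or column whose
step is horizontal meets all the rows and columns whose steps come later, and itself. -/
def diagramRel : List (ℕ × Bool) → ℕ → ℕ → Prop
  | [], _, _ => False
  | p :: L, i, j => p.2 = true ∧ (i = p.1 ∧ (j = p.1 ∨ j ∈ labels L) ∨ j = p.1 ∧ i ∈ labels L) ∨
      diagramRel L i j

theorem diagramRel_symm (L : List (ℕ × Bool)) (i j : ℕ) :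
    diagramRel L i j → diagramRel L j i := by
  induction L with
  | nil => exact id
  | cons p L ih =>
    simp only [diagramRel]
    rintro (⟨h, h'⟩ | h)
    · left
      grind
    · exact Or.inr (ih h)

theorem mem_labels_of_diagramRel {L : List (ℕ × Bool)} {i j : ℕ} :
    diagramRel L i j → i ∈ labels L ∧ j ∈ labels L := by
  induction L with
  | nil => exact False.elim
  | cons p L ih =>
    simp only [diagramRel, labels_cons, Finset.mem_insert]
    rintro (h | h)
    · tauto
    · have := ih h
      tauto

/-- The labels of a word are compatible with the order of rows and columns: columns are met in
increasing order, rows in decreasing order, and the rows met lie below the columns met. -/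
def Compatible (L : List (ℕ × Bool)) : Prop :=
  L.Pairwise fun p q => if p.2 then p.1 < q.1 else q.1 < p.1

theorem Compatible.tail {p : ℕ × Bool} {L : List (ℕ × Bool)} (h : Compatible (p :: L)) :
    Compatible L := (List.pairwise_cons.1 h).2

theorem Compatible.lt_or_lt {p : ℕ × Bool} {L : List (ℕ × Bool)} (h : Compatible (p :: L)) {k : ℕ}
    (hk : k ∈ labels L) : if p.2 then p.1 < k else k < p.1 := by
  simp only [labels, List.mem_toFinset, List.mem_map] at hk
  obtain ⟨q, hq, rfl⟩ := hk
  exact (List.pairwise_cons.1 h).1 q hq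

theorem diagramRel_delete (u v : List (ℕ × Bool)) (p : ℕ × Bool) {i j : ℕ} (hi : i ≠ p.1)
    (hj : j ≠ p.1) : diagramRel (u ++ p :: v) i j ↔ diagramRel (u ++ v) i j := by
  induction u with
  | nil => simp [diagramRel, hi, hj]
  | cons q u ih => simp [diagramRel, ih, hi, hj]

theorem diagramRel_swap (u v : List (ℕ × Bool)) (a b i j : ℕ) :
    diagramRel (u ++ (b, true) :: (a, false) :: v) i j ↔
      diagramRel (u ++ (a, false) :: (b, true) :: v) i j ∨ i = a ∧ j = b ∨ i = b ∧ j = a := by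
  induction u with
  | nil => simp [diagramRel]; tauto
  | cons q u ih =>
    have : labels (u ++ (b, true) :: (a, false) :: v) =
        labels (u ++ (a, false) :: (b, true) :: v) := by
      simp [Finset.insert_comm]
    simp only [List.cons_append, diagramRel, ih, this, or_assoc]

/-- Exchanging the two kinds of last step only changes a box of the main diagonal. -/
theorem diagramRel_last (u : List (ℕ × Bool)) (a : ℕ) {i j : ℕ} (hij : i ≠ j) :
    diagramRel (u ++ [(a, true)]) i j ↔ diagramRel (u ++ [(a, false)]) i j := by
  induction u with
  | nil => simp [diagramRel]; grind
  | cons q u ih => simp [diagramRel, ih]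

/-- The steps `b` and `a`, horizontal and vertical in this order, form a corner `(a, b)` of the
diagram, which is removed when they are exchanged. -/
theorem le_of_diagramRel_corner {u v : List (ℕ × Bool)} {a b : ℕ}
    (h : Compatible (u ++ (b, true) :: (a, false) :: v)) :
    (∀ k, diagramRel (u ++ (b, true) :: (a, false) :: v) k a → k ≤ b) ∧
    (∀ k, diagramRel (u ++ (b, true) :: (a, false) :: v) b k → k ≤ a) ∧
    ¬diagramRel (u ++ (a, false) :: (b, true) :: v) a b ∧
    ¬diagramRel (u ++ (a, false) :: (b, true) :: v) b a ∧ b < a := by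
  induction u with
  | nil =>
    have hba : b < a := by simpa using h.lt_or_lt (k := a) (by simp)
    have ha : ∀ k ∈ labels v, k < a := fun k hk => by simpa using h.tail.lt_or_lt hk
    have hb : ∀ k ∈ labels v, b < k := fun k hk => by simpa using h.lt_or_lt (k := k) (by simp [hk])
    have hav : a ∉ labels v := fun h => lt_irrefl _ (ha a h)
    have hbv : b ∉ labels v := fun h => lt_irrefl _ (hb b h)
    have e1 : ∀ k, ¬diagramRel v k a := fun k hk => hav (mem_labels_of_diagramRel hk).2
    have e2 : ∀ k, ¬diagramRel v b k := fun k hk => hbv (mem_labels_of_diagramRel hk).1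
    have e3 : ∀ k, ¬diagramRel v a k := fun k hk => hav (mem_labels_of_diagramRel hk).1
    simp only [List.nil_append, diagramRel, labels_cons, Finset.mem_insert, Bool.false_eq_true,
      false_and, false_or, true_and]
    refine ⟨fun k hk => ?_, fun k hk => ?_, ?_, ?_, hba⟩
    · rcases hk with (h | h) | h
      · omega
      · omega
      · exact absurd h (e1 k)
    · have := ha k
      have := e2 k
      clear h e1 e2 e3
      grind
    · have := e3 b
      have := hba.ne'
      tauto
    · have := e2 a
      have := hba.ne'
      tauto
  | cons q u ih =>
    obtain ⟨i1, i2, i3, i4, i5⟩ := ih h.tail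
    have hqa := h.lt_or_lt (k := a) (by simp)
    have hqb := h.lt_or_lt (k := b) (by simp)
    simp only [List.cons_append, diagramRel]
    grind

theorem Compatible.swap {u v : List (ℕ × Bool)} {a b : ℕ}
    (h : Compatible (u ++ (b, true) :: (a, false) :: v)) (hba : b < a) :
    Compatible (u ++ (a, false) :: (b, true) :: v) := by
  unfold Compatible at h ⊢
  rw [List.pairwise_append] at h ⊢
  simp only [List.pairwise_cons, List.mem_cons, if_true, Bool.false_eq_true, if_false] at h ⊢
  obtain ⟨h1, ⟨h2, h3, h4⟩, h5⟩ := h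
  refine ⟨h1, ⟨?_, ?_, h4⟩, fun x hx y hy => h5 x hx y (by tauto)⟩
  · rintro y (rfl | hy)
    · exact hba
    · exact h3 y hy
  · exact fun y hy => h2 y (Or.inr hy)

/-! ### The number of fillings of a diagram -/

/-- The value of a border word in a representation of the relations satisfied by the numbers of
fillings: the weight of the state `k` is multiplied by `k` by a vertical step, and a horizontal step
sends it to the state `k + 1` minus `k` times the state `k`. -/
def wordValue : ℕ → List Bool → ℤ
  | k, [] => 2 ^ (k - 1) * (k - 1).factorial
  | k, false :: w => k * wordValue k w
  | k, true :: w => wordValue (k + 1) w - k * wordValue k w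

theorem wordValue_corner (k : ℕ) (u v : List Bool) :
    wordValue k (u ++ true :: false :: v) = wordValue k (u ++ false :: true :: v) +
      wordValue k (u ++ true :: v) + wordValue k (u ++ false :: v) := by
  induction u generalizing k with
  | nil => simp [wordValue]; ring
  | cons c u ih => cases c <;> simp only [List.cons_append, wordValue, ih] <;> ring

theorem wordValue_last {k : ℕ} (hk : 1 ≤ k) (u : List Bool) :
    wordValue k (u ++ [true]) = wordValue k (u ++ [false]) := by
  induction u generalizing k with
  | nil =>
    obtain ⟨k, rfl⟩ := Nat.exists_eq_add_of_le' hk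
    simp [wordValue, Nat.factorial_succ, pow_succ]
    ring
  | cons c u ih => cases c <;> simp [wordValue, ih hk, ih (Nat.le_succ_of_le hk)]

/-- The number of symmetric fillings of a symmetric diagram. A word containing a vertical step is
reduced by moving this step to the front, across the corners on its way. A word ending with a
horizontal step has the same fillings as the word ending with a vertical step, as a box on the main
diagonal is not pointed. -/
theorem ncard_parentMaps_diagramRel (L : List (ℕ × Bool)) (hL : Compatible L)
    (h0 : 0 ∉ labels L) :
    ((parentMaps (labels L) (diagramRel L)).ncard : ℤ) = wordValue 1 (L.map Prod.snd) := by
  induction hn : L.length using Nat.strong_induction_on generalizing L with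
  | _ n IH =>
  subst hn
  have vertical : ∀ (u v : List (ℕ × Bool)) (a : ℕ), (u ++ (a, false) :: v).length = L.length →
      Compatible (u ++ (a, false) :: v) → 0 ∉ labels (u ++ (a, false) :: v) →
      ((parentMaps (labels (u ++ (a, false) :: v))
        (diagramRel (u ++ (a, false) :: v))).ncard : ℤ) =
        wordValue 1 ((u ++ (a, false) :: v).map Prod.snd) := by
    intro u
    induction u using List.reverseRecOn with
    | nil =>
      intro v a hlen hcomp h0
      -- A vertical first step gives a row whose only cell lies in the first column: `m a = 0`.
      have hav : a ∉ labels v := fun h => by simpa using hcomp.lt_or_lt h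
      have ha0 : a ≠ 0 := fun h => h0 (by simp [h])
      have : parentMaps (labels ([] ++ (a, false) :: v)) (diagramRel ([] ++ (a, false) :: v)) =
          parentMaps (labels v) (diagramRel v) := by
        ext m
        simp only [parentMaps, List.nil_append, diagramRel, labels_cons, Finset.mem_insert,
          Set.mem_ofPred_eq]
        constructor
        · rintro ⟨h1, h2⟩
          refine ⟨fun k hk => ?_, fun k hk => ?_⟩
          · rcases eq_or_ne k a with rfl | hka
            · rcases (h2 k (by simp)).1 with h | h
              · exact h
              · have := mem_labels_of_diagramRel (h.2.resolve_left (by simp))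
                tauto
            · exact h1 k (by tauto)
          · have := h2 k (Or.inr hk)
            refine ⟨this.1.imp id fun h => ?_, this.2⟩
            have := h.2.resolve_left (by simp)
            exact ⟨(mem_labels_of_diagramRel this).2, this⟩
        · rintro ⟨h1, h2⟩
          refine ⟨fun k hk => h1 k (by tauto), ?_⟩
          rintro k (rfl | hk)
          · rw [h1 _ hav]
            have : (0 : ℕ) ∉ labels v := fun h => h0 (by simp [h])
            rw [h1 _ this]
            exact ⟨Or.inl rfl, Nat.pos_of_ne_zero ha0⟩
          · have := h2 k hk
            tauto
      rw [this, IH v.length (by rw [← hlen]; simp) v hcomp.tail (fun h => h0 (by simp [h])) rfl]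
      simp [wordValue]
    | append_singleton u p ih =>
      obtain ⟨b, t⟩ := p
      intro v a hlen hcomp h0
      rw [List.append_assoc, List.singleton_append] at hlen hcomp h0 ⊢
      cases t with
      | false => exact ih _ b hlen hcomp h0
      | true =>
        obtain ⟨h1, h2, h3, h4, h5⟩ := le_of_diagramRel_corner hcomp
        have hd : ∀ {x}, x ∈ labels u ∨ x ∈ labels v → x ≠ a ∧ x ≠ b := by
          have hnd : ((u ++ (b, true) :: (a, false) :: v).map Prod.fst).Nodup := by
            rw [List.nodup_iff_pairwise_ne, List.pairwise_map]
            refine hcomp.imp fun {p q} h => ?_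
            split_ifs at h <;> omega
          simp only [labels, List.mem_toFinset]
          simp only [List.map_append, List.map_cons, List.nodup_append, List.nodup_cons,
            List.mem_cons] at hnd
          grind
        have ea : (labels (u ++ (b, true) :: (a, false) :: v)).erase a =
            labels (u ++ (b, true) :: v) := by
          ext x
          have := @hd x
          simp
          grind
        have eb : (labels (u ++ (b, true) :: (a, false) :: v)).erase b =
            labels (u ++ (a, false) :: v) := by
          ext x
          have := @hd x
          simp
          grind
        have es : labels (u ++ (b, true) :: (a, false) :: v) =
            labels (u ++ (a, false) :: (b, true) :: v) := by
          ext x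
          simp
          grind
        have sub1 : (u ++ (b, true) :: v).Sublist (u ++ (b, true) :: (a, false) :: v) :=
          List.Sublist.append_left (by simp) _
        have sub2 : (u ++ (a, false) :: v).Sublist (u ++ (b, true) :: (a, false) :: v) :=
          List.Sublist.append_left (by simp) _
        have hswap := hcomp.swap h5
        rw [ncard_parentMaps_corner (a := a) (b := b) h0 (by simp) (by simp) h5.ne'
          (diagramRel_symm _) h1 h2 (diagramRel_swap u v a b) h3 h4, ea, eb,
          parentMaps_congr (V := labels (u ++ (b, true) :: v))
            (R' := diagramRel (u ++ (b, true) :: v)) ?_,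
          parentMaps_congr (V := labels (u ++ (a, false) :: v))
            (R' := diagramRel (u ++ (a, false) :: v)) ?_, es]
        · push_cast
          rw [ih ((b, true) :: v) a (by rw [← hlen]; simp) hswap (es ▸ h0),
            IH _ (by rw [← hlen]; simp) _ (hcomp.sublist sub1)
              (fun h => h0 (Finset.mem_of_mem_erase (ea ▸ h))) rfl,
            IH _ (by rw [← hlen]; simp) _ (hcomp.sublist sub2)
              (fun h => h0 (Finset.mem_of_mem_erase (eb ▸ h))) rfl]
          simp [wordValue_corner]
        · intro i hi j hj _
          rw [← eb, Finset.mem_erase] at hi hj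
          exact diagramRel_delete u _ (b, true) hi.1 hj.1
        · intro i hi j hj _
          rw [← ea, Finset.mem_erase] at hi hj
          simpa using diagramRel_delete (u ++ [(b, true)]) v (a, false) hi.1 hj.1
  -- If the last step is horizontal, it can be replaced by a vertical one.
  rcases List.eq_nil_or_concat L with rfl | ⟨u, ⟨a, t⟩, rfl⟩
  · have : parentMaps (labels []) (diagramRel []) = {fun _ => 0} := by
      ext m
      simp [parentMaps, funext_iff]
    rw [this]
    simp [wordValue]
  · rw [List.concat_eq_append] at *
    cases t with
    | false => exact vertical u [] a rfl hL h0
    | true =>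
      have h := vertical u [] a (by simp) (by
        unfold Compatible at hL ⊢
        rw [List.pairwise_append] at hL ⊢
        simpa using hL) (by simpa using h0)
      rw [List.map_append, List.map_cons, List.map_nil, wordValue_last le_rfl]
      rw [List.map_append, List.map_cons, List.map_nil] at h
      rw [← h, parentMaps_congr (R' := diagramRel (u ++ [(a, false)]))
        (fun i _ j _ hij => diagramRel_last u a hij)]
      simp

/-! ### Symmetric diagrams and border words -/

/-- The labels of a border word starting in column `b`, all rows of index at least
`b + w.length` being already passed. -/
def labelWord : ℕ → List Bool → List (ℕ × Bool)
  | _, [] => []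
  | b, true :: w => (b, true) :: labelWord (b + 1) w
  | b, false :: w => (b + w.length, false) :: labelWord b w

theorem mem_labels_labelWord {b i : ℕ} {w : List Bool} :
    i ∈ labels (labelWord b w) ↔ b ≤ i ∧ i < b + w.length := by
  induction w generalizing b with
  | nil => simp [labelWord]
  | cons c w ih => cases c <;> simp [labelWord, ih] <;> omega

theorem map_snd_labelWord (b : ℕ) (w : List Bool) : (labelWord b w).map Prod.snd = w := by
  induction w generalizing b with
  | nil => rfl
  | cons c w ih => cases c <;> simp [labelWord, ih]

theorem compatible_labelWord (b : ℕ) (w : List Bool) : Compatible (labelWord b w) := by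
  have key (b : ℕ) (w : List Bool) (q) (hq : q ∈ labelWord b w) :
      b ≤ q.1 ∧ q.1 < b + w.length :=
    mem_labels_labelWord.1 (by
      simp only [labels, List.mem_toFinset]
      exact List.mem_map_of_mem hq)
  induction w generalizing b with
  | nil => exact List.Pairwise.nil
  | cons c w ih =>
    cases c
    · refine List.pairwise_cons.2 ⟨fun q hq => ?_, ih b⟩
      simpa using (key _ _ q hq).2
    · refine List.pairwise_cons.2 ⟨fun q hq => ?_, ih (b + 1)⟩
      simpa using (key _ _ q hq).1

theorem le_of_diagramRel_labelWord {b i j : ℕ} {w : List Bool}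
    (h : diagramRel (labelWord b w) i j) :
    (b ≤ i ∧ i < b + w.length) ∧ b ≤ j ∧ j < b + w.length := by
  simpa only [mem_labels_labelWord] using mem_labels_of_diagramRel h

theorem diagramRel_labelWord_true {b i j : ℕ} {w : List Bool} :
    diagramRel (labelWord b (true :: w)) i j ↔
      i = b ∧ (b ≤ j ∧ j ≤ b + w.length) ∨ j = b ∧ (b ≤ i ∧ i ≤ b + w.length) ∨
        diagramRel (labelWord (b + 1) w) i j := by
  simp only [labelWord, diagramRel, mem_labels_labelWord]
  rw [← or_assoc]
  refine or_congr_left ?_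
  simp only [true_and]
  omega

theorem diagramRel_labelWord_false {b i j : ℕ} {w : List Bool} :
    diagramRel (labelWord b (false :: w)) i j ↔ diagramRel (labelWord b w) i j := by
  simp [labelWord, diagramRel]

theorem diagramRel_labelWord_of_le {b i j i' j' : ℕ} {w : List Bool}
    (h : diagramRel (labelWord b w) i j) (hi : b ≤ i') (hj : b ≤ j') (hi' : i' ≤ i) (hj' : j' ≤ j) :
    diagramRel (labelWord b w) i' j' := by
  induction w generalizing b with
  | nil => exact h
  | cons c w ih =>
    have hb := le_of_diagramRel_labelWord h
    simp only [List.length_cons] at hb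
    cases c
    · rw [diagramRel_labelWord_false] at h ⊢
      exact ih h hi hj
    · rw [diagramRel_labelWord_true] at h ⊢
      rcases eq_or_ne i' b with rfl | hi''
      · exact Or.inl ⟨rfl, by omega⟩
      rcases eq_or_ne j' b with rfl | hj''
      · exact Or.inr (Or.inl ⟨rfl, by omega⟩)
      rcases h with h | h | h
      · omega
      · omega
      · exact Or.inr (Or.inr (ih h (by omega) (by omega)))

/-- Every symmetric diagram in a square has a border word. -/
theorem exists_diagramRel_labelWord (n : ℕ) {b : ℕ} {S : ℕ → ℕ → Prop}
    (hsymm : ∀ i j, S i j → S j i) (hb : ∀ i j, S i j → b ≤ i ∧ i < b + n)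
    (hS : ∀ i j i' j', S i j → b ≤ i' → b ≤ j' → i' ≤ i → j' ≤ j → S i' j') :
    ∃ w : List Bool, w.length = n ∧ ∀ i j, S i j ↔ diagramRel (labelWord b w) i j := by
  induction n generalizing b S with
  | zero =>
    refine ⟨[], rfl, fun i j => ?_⟩
    simp only [labelWord, diagramRel, iff_false]
    intro h
    have := hb _ _ h
    omega
  | succ n ih =>
    by_cases h : S (b + n) b
    · obtain ⟨w, hw, hw'⟩ := ih (b := b + 1) (S := fun i j => S i j ∧ b + 1 ≤ i ∧ b + 1 ≤ j)
        (fun i j hij => ⟨hsymm _ _ hij.1, hij.2.2, hij.2.1⟩)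
        (fun i j hij => by
          have := hb _ _ hij.1
          omega)
        (fun i j i' j' hij h1 h2 h3 h4 => ⟨hS i j i' j' hij.1 (by omega) (by omega) h3 h4, h1, h2⟩)
      refine ⟨true :: w, by simp [hw], fun i j => ?_⟩
      rw [diagramRel_labelWord_true, ← hw', hw]
      constructor
      · intro hij
        have h1 := hb _ _ hij
        have h2 := hb _ _ (hsymm _ _ hij)
        by_cases h3 : i = b
        · exact Or.inl ⟨h3, by omega⟩
        by_cases h4 : j = b
        · exact Or.inr (Or.inl ⟨h4, by omega⟩)
        · exact Or.inr (Or.inr ⟨hij, by omega⟩)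
      · rintro (⟨rfl, h1⟩ | ⟨rfl, h1⟩ | h1)
        · exact hsymm _ _ (hS _ _ _ _ h h1.1 le_rfl h1.2 le_rfl)
        · exact hS _ _ _ _ h h1.1 le_rfl h1.2 le_rfl
        · exact h1.1
    · obtain ⟨w, hw, hw'⟩ := ih (b := b) (S := S) hsymm (fun i j hij => by
        have h1 := hb _ _ hij
        refine ⟨h1.1, lt_of_le_of_ne (by omega) fun h2 => h ?_⟩
        exact hS i j (b + n) b hij (by omega) le_rfl h2.ge (hb _ _ (hsymm _ _ hij)).1) hS
      refine ⟨false :: w, by simp [hw], fun i j => ?_⟩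
      rw [diagramRel_labelWord_false, hw']

/-- A symmetric diagram in a square of given size has at most one border word. -/
theorem labelWord_injective {b : ℕ} {w w' : List Bool} (hlen : w.length = w'.length)
    (h : ∀ i j, diagramRel (labelWord b w) i j ↔ diagramRel (labelWord b w') i j) : w = w' := by
  induction w generalizing b w' with
  | nil => exact (List.length_eq_zero_iff.1 hlen.symm).symm
  | cons c w ih =>
    obtain _ | ⟨c', w'⟩ := w'
    · simp at hlen
    simp only [List.length_cons, Nat.add_right_cancel_iff] at hlen
    have hcorner (w : List Bool) : ¬diagramRel (labelWord b w) (b + w.length) b := fun h => by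
      have := le_of_diagramRel_labelWord h
      omega
    cases c <;> cases c'
    · simp only [diagramRel_labelWord_false] at h
      rw [ih hlen h]
    · refine absurd ((h (b + w.length) b).2 ?_) ?_
      · rw [diagramRel_labelWord_true]
        exact Or.inr (Or.inl ⟨rfl, by omega⟩)
      · rw [diagramRel_labelWord_false]
        exact hcorner w
    · refine absurd ((h (b + w.length) b).1 ?_) ?_
      · rw [diagramRel_labelWord_true]
        exact Or.inr (Or.inl ⟨rfl, by omega⟩)
      · rw [diagramRel_labelWord_false, hlen]
        exact hcorner w'
    · rw [ih (b := b + 1) hlen fun i j => ?_]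
      have hij := h i j
      simp only [diagramRel_labelWord_true] at hij
      constructor
      · intro h1
        have := le_of_diagramRel_labelWord h1
        have := hij.1 (Or.inr (Or.inr h1))
        rcases this with h2 | h2 | h2
        · omega
        · omega
        · exact h2
      · intro h1
        have := le_of_diagramRel_labelWord h1
        have := hij.2 (Or.inr (Or.inr h1))
        rcases this with h2 | h2 | h2
        · omega
        · omega
        · exact h2

open Classical in
theorem card_diagonal_diagramRel {L : List (ℕ × Bool)} (hL : Compatible L) :
    ((labels L).filter fun i => diagramRel L i i).card = (L.map Prod.snd).count true := by
  induction L with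
  | nil => simp
  | cons p L ih =>
    have hp : p.1 ∉ labels L := fun h => by
      have := hL.lt_or_lt h
      split_ifs at this <;> omega
    have e : ((labels L).filter fun i => diagramRel (p :: L) i i) =
        (labels L).filter fun i => diagramRel L i i := by
      refine Finset.filter_congr fun i hi => ?_
      have : i ≠ p.1 := fun h => hp (h ▸ hi)
      simp [diagramRel, this]
    have hp' : ¬diagramRel L p.1 p.1 := fun h => hp (mem_labels_of_diagramRel h).1
    obtain ⟨a, t⟩ := p
    rw [labels_cons, Finset.filter_insert, e]
    cases t
    · simpa [diagramRel, hp'] using ih hL.tail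
    · rw [if_pos (by simp [diagramRel]), Finset.card_insert_of_notMem (by simp [hp])]
      simpa using ih hL.tail

open Classical in
/-- The symmetric Young diagram with `w.length + 1` rows with border word `true :: w`: the border
always starts with the horizontal step below the first column. -/
noncomputable def borderDiagram (w : List Bool) : YoungDiagram where
  cells := (Finset.range (w.length + 1) ×ˢ Finset.range (w.length + 1)).filter
    fun c => diagramRel (labelWord 0 (true :: w)) c.1 c.2
  isLowerSet := by
    rintro ⟨i, j⟩ ⟨i', j'⟩ ⟨h1, h2⟩ h
    simp only [Finset.coe_filter, Finset.mem_product, Finset.mem_range, Set.mem_ofPred_eq] at h ⊢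
    exact ⟨by simp only at h1 h2; omega,
      diagramRel_labelWord_of_le h.2 (Nat.zero_le _) (Nat.zero_le _) h1 h2⟩

theorem mem_borderDiagram {w : List Bool} {i j : ℕ} :
    (i, j) ∈ borderDiagram w ↔ diagramRel (labelWord 0 (true :: w)) i j := by
  rw [← YoungDiagram.mem_cells]
  simp only [borderDiagram, Finset.mem_filter, Finset.mem_product, Finset.mem_range,
    and_iff_right_iff_imp]
  intro h
  have := le_of_diagramRel_labelWord h
  simp only [List.length_cons] at this
  omega

theorem mem_borderDiagram_zero {w : List Bool} {i : ℕ} :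
    (i, 0) ∈ borderDiagram w ↔ i ≤ w.length := by
  rw [mem_borderDiagram, diagramRel_labelWord_true]
  constructor
  · rintro (h | h | h)
    · omega
    · omega
    · have := le_of_diagramRel_labelWord h
      omega
  · exact fun h => Or.inr (Or.inl (by omega))

theorem mem_borderDiagram_comm {w : List Bool} {i j : ℕ} :
    (i, j) ∈ borderDiagram w ↔ (j, i) ∈ borderDiagram w := by
  rw [mem_borderDiagram, mem_borderDiagram]
  exact ⟨diagramRel_symm _ _ _, diagramRel_symm _ _ _⟩

theorem mem_borderDiagram_of_pos {w : List Bool} {i j : ℕ} (hi : i ≠ 0) (hj : j ≠ 0) :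
    (i, j) ∈ borderDiagram w ↔ diagramRel (labelWord 1 w) i j := by
  rw [mem_borderDiagram, diagramRel_labelWord_true]
  simp [hi, hj]

theorem borderDiagram_colLen (w : List Bool) : (borderDiagram w).colLen 0 = w.length + 1 := by
  have h (i : ℕ) : i < (borderDiagram w).colLen 0 ↔ i ≤ w.length := by
    rw [← YoungDiagram.mem_iff_lt_colLen, mem_borderDiagram_zero]
  have h1 := h w.length
  have h2 := h (w.length + 1)
  omega

theorem borderDiagram_rowLen (w : List Bool) : (borderDiagram w).rowLen 0 = w.length + 1 := by
  have h (i : ℕ) : i < (borderDiagram w).rowLen 0 ↔ i ≤ w.length := by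
    rw [← YoungDiagram.mem_iff_lt_rowLen, mem_borderDiagram_comm, mem_borderDiagram_zero]
  have h1 := h w.length
  have h2 := h (w.length + 1)
  omega

theorem card_diagonal_borderDiagram (w : List Bool) :
    ((borderDiagram w).cells.filter fun c => c.1 = c.2).card = w.count true + 1 := by
  classical
  have h := card_diagonal_diagramRel (compatible_labelWord 0 (true :: w))
  rw [map_snd_labelWord, List.count_cons_self] at h
  rw [← h]
  refine Finset.card_bij (fun c _ => c.1) ?_ ?_ ?_
  · rintro ⟨i, j⟩ hij
    simp only [Finset.mem_filter, YoungDiagram.mem_cells, mem_borderDiagram] at hij ⊢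
    obtain ⟨h, rfl⟩ := hij
    exact ⟨(mem_labels_of_diagramRel h).1, h⟩
  · rintro ⟨i, j⟩ hij ⟨i', j'⟩ hij' h
    simp only [Finset.mem_filter] at hij hij'
    simp_all
  · intro i hi
    rw [Finset.mem_filter] at hi
    refine ⟨(i, i), ?_, rfl⟩
    simp only [Finset.mem_filter, YoungDiagram.mem_cells, mem_borderDiagram, and_true]
    exact hi.2

/-! ### Symmetric tableaux and parent maps -/

/-- The parent maps describing the fillings of the diagram with border word `true :: w`. -/
abbrev fillings (w : List Bool) : Set (ℕ → ℕ) :=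
  parentMaps (labels (labelWord 1 w)) (diagramRel (labelWord 1 w))

theorem zero_notMem_labels_labelWord (w : List Bool) : 0 ∉ labels (labelWord 1 w) := by
  simp [mem_labels_labelWord]

theorem apply_zero_of_mem_fillings {w : List Bool} {m : ℕ → ℕ} (hm : m ∈ fillings w) : m 0 = 0 :=
  hm.1 0 (zero_notMem_labels_labelWord w)

theorem apply_apply_lt_of_mem_fillings {w : List Bool} {m : ℕ → ℕ} (hm : m ∈ fillings w) {k : ℕ}
    (hk : m k ≠ 0) : m (m k) < k :=
  (hm.2 k (by
    by_contra h
    exact hk (hm.1 k h))).2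

theorem apply_le_of_mem_fillings {w : List Bool} {m : ℕ → ℕ} (hm : m ∈ fillings w) (k : ℕ) :
    m k ≤ w.length := by
  by_cases hk : k ∈ labels (labelWord 1 w)
  · rcases (hm.2 k hk).1 with h | h
    · omega
    · have := mem_labels_labelWord.1 h.1
      omega
  · rw [hm.1 k hk]
    exact Nat.zero_le _

/-- `m k` is the column of the leftmost point of row `k`. -/
theorem le_of_mem_fillings {w : List Bool} {m : ℕ → ℕ} (hm : m ∈ fillings w) {i j : ℕ}
    (h : m i = j ∨ m j = i) : m i ≤ j := by
  rcases h with rfl | rfl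
  · exact le_rfl
  · by_cases h : m j = 0
    · rw [h, apply_zero_of_mem_fillings hm]
      exact Nat.zero_le _
    · exact (apply_apply_lt_of_mem_fillings hm h).le

/-- The symmetric tableau with border word `true :: w` such that `m k` is the column of the
leftmost point of row `k`. -/
noncomputable def tableauOfFilling {n : ℕ} {w : List Bool} (hw : w.length = n) {m : ℕ → ℕ}
    (hm : m ∈ fillings w) : SymmetricTreeLikeTableau (2 * n + 1) where
  val :=
    { shape := borderDiagram w
      points := (Finset.range (n + 1) ×ˢ Finset.range (n + 1)).filter
        fun c => m c.1 = c.2 ∨ m c.2 = c.1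
      points_subset := by
        have key : ∀ i ≤ n, (i, m i) ∈ borderDiagram w := by
          intro i hi
          by_cases h : i ∈ labels (labelWord 1 w)
          · rcases (hm.2 i h).1 with h' | h'
            · rw [h', mem_borderDiagram_zero, hw]
              exact hi
            · have h1 := mem_labels_labelWord.1 h
              have h2 := mem_labels_labelWord.1 h'.1
              rw [mem_borderDiagram_of_pos (by omega) (by omega)]
              exact h'.2
          · rw [hm.1 i h, mem_borderDiagram_zero, hw]
            exact hi
        rintro ⟨i, j⟩ hij
        simp only [Finset.mem_filter, Finset.mem_product, Finset.mem_range] at hij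
        rw [YoungDiagram.mem_cells]
        obtain ⟨⟨hi, hj⟩, rfl | rfl⟩ := hij
        · exact key i (by omega)
        · rw [mem_borderDiagram_comm]
          exact key j (by omega)
      halfPerimeter_eq := by
        rw [borderDiagram_colLen, borderDiagram_rowLen]
        omega
      root_mem := by simp [apply_zero_of_mem_fillings hm]
      exists_point_row := by
        intro i hi
        rw [borderDiagram_colLen] at hi
        have := apply_le_of_mem_fillings hm i
        refine ⟨m i, ?_⟩
        simp
        omega
      exists_point_col := by
        intro j hj
        rw [borderDiagram_rowLen] at hj
        have := apply_le_of_mem_fillings hm j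
        refine ⟨m j, ?_⟩
        simp
        omega
      above_xor_left := by
        intro i j hij h0
        simp only [Finset.mem_filter, Finset.mem_product, Finset.mem_range] at hij ⊢
        have hm0 := apply_zero_of_mem_fillings hm
        obtain ⟨⟨hi, hj⟩, rfl | rfl⟩ := hij
        · have hi0 : i ≠ 0 := by
            rintro rfl
            simp [hm0] at h0
          have hlt : m (m i) < i := by
            by_cases h : m i = 0
            · rw [h, hm0]
              omega
            · exact apply_apply_lt_of_mem_fillings hm h
          refine Or.inl ⟨⟨m (m i), hlt, by omega, by simp⟩, ?_⟩
          rintro ⟨j', hj', -, h⟩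
          exact absurd (le_of_mem_fillings hm h) (by omega)
        · have hj0 : j ≠ 0 := by
            rintro rfl
            simp [hm0] at h0
          have hlt : m (m j) < j := by
            by_cases h : m j = 0
            · rw [h, hm0]
              omega
            · exact apply_apply_lt_of_mem_fillings hm h
          refine Or.inr ⟨⟨m (m j), hlt, by omega, by simp⟩, ?_⟩
          rintro ⟨i', hi', -, h⟩
          exact absurd (le_of_mem_fillings hm h.symm) (by omega) }
  property := by
    refine ⟨?_, fun i j => ?_⟩
    · ext ⟨i, j⟩
      simp only [YoungDiagram.mem_cells, YoungDiagram.mem_transpose, Prod.swap_prod_mk]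
      exact mem_borderDiagram_comm
    · simp only [Finset.mem_filter, Finset.mem_product, Finset.mem_range]
      tauto

theorem tableauOfFilling_injective {n : ℕ} {w w' : List Bool} (hw : w.length = n)
    (hw' : w'.length = n) {m m' : ℕ → ℕ} (hm : m ∈ fillings w) (hm' : m' ∈ fillings w')
    (h : tableauOfFilling hw hm = tableauOfFilling hw' hm') : w = w' ∧ m = m' := by
  have hshape : borderDiagram w = borderDiagram w' := congrArg (fun T => T.1.shape) h
  have hpoints : (tableauOfFilling hw hm).1.points = (tableauOfFilling hw' hm').1.points :=
    congrArg (fun T => T.1.points) h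
  have hww : w = w' := by
    have := labelWord_injective (b := 0) (w := true :: w) (w' := true :: w') (by simp [hw, hw'])
      fun i j => by rw [← mem_borderDiagram, ← mem_borderDiagram, hshape]
    simpa using this
  subst hww
  refine ⟨rfl, ?_⟩
  have hp : ∀ i ≤ n, ∀ j ≤ n, (m i = j ∨ m j = i) ↔ (m' i = j ∨ m' j = i) := by
    intro i hi j hj
    have := Finset.ext_iff.1 hpoints (i, j)
    simpa [tableauOfFilling, Nat.lt_succ_of_le hi, Nat.lt_succ_of_le hj] using this
  ext k
  by_cases hk : k ≤ n
  · have h1 := apply_le_of_mem_fillings hm k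
    have h2 := apply_le_of_mem_fillings hm' k
    refine le_antisymm (le_of_mem_fillings hm ?_) (le_of_mem_fillings hm' ?_)
    · exact (hp k hk _ (hw ▸ h2)).2 (Or.inl rfl)
    · exact (hp k hk _ (hw ▸ h1)).1 (Or.inl rfl)
  · have : k ∉ labels (labelWord 1 w) := by
      rw [mem_labels_labelWord]
      omega
    rw [hm.1 k this, hm'.1 k this]

theorem exists_tableauOfFilling {n : ℕ} (T : SymmetricTreeLikeTableau (2 * n + 1)) :
    ∃ (w : List Bool) (hw : w.length = n) (m : ℕ → ℕ) (hm : m ∈ fillings w),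
      tableauOfFilling hw hm = T := by
  obtain ⟨T, hshape, hsymm⟩ := T
  have hlen : T.shape.colLen 0 = n + 1 ∧ T.shape.rowLen 0 = n + 1 := by
    have h1 := T.halfPerimeter_eq
    have h2 : T.shape.colLen 0 = T.shape.rowLen 0 := by
      conv_lhs => rw [← hshape]
      exact YoungDiagram.colLen_transpose _ _
    omega
  have hS : ∀ i j, (i, j) ∈ T.shape → (j, i) ∈ T.shape := by
    intro i j h
    rw [← hshape, YoungDiagram.mem_transpose]
    exact h
  have hle : ∀ i j, (i, j) ∈ T.shape → i < n + 1 := by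
    intro i j h
    have := T.shape.up_left_mem le_rfl (Nat.zero_le _) h
    rwa [YoungDiagram.mem_iff_lt_colLen, hlen.1] at this
  have hmem : ∀ {i j}, (i, j) ∈ T.points → (i, j) ∈ T.shape := fun h => T.points_subset h
  obtain ⟨w, hw, hSw⟩ := exists_diagramRel_labelWord (n + 1) (b := 0)
    (S := fun i j => (i, j) ∈ T.shape) hS
    (fun i j h => ⟨Nat.zero_le _, by simpa using hle i j h⟩)
    (fun i j i' j' h _ _ hi hj => T.shape.up_left_mem hi hj h)
  obtain _ | ⟨c, w⟩ := w
  · simp at hw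
  simp only [List.length_cons, Nat.add_right_cancel_iff] at hw
  have hc : c = true := by
    cases c
    · have h : (n, 0) ∈ T.shape := by
        rw [YoungDiagram.mem_iff_lt_colLen, hlen.1]
        omega
      rw [hSw, diagramRel_labelWord_false] at h
      have := le_of_diagramRel_labelWord h
      omega
    · rfl
  subst hc
  have hdiag : borderDiagram w = T.shape := by
    ext ⟨i, j⟩
    rw [YoungDiagram.mem_cells, YoungDiagram.mem_cells, mem_borderDiagram, hSw]
  -- The column of the leftmost point in row `k`; the junk value `0` is right for `k > n`.
  let m : ℕ → ℕ := fun k => sInf {j | (k, j) ∈ T.points}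
  have hmle : ∀ {k j}, (k, j) ∈ T.points → m k ≤ j := fun h => Nat.sInf_le h
  have hmpt : ∀ k ≤ n, (k, m k) ∈ T.points := fun k hk =>
    Nat.sInf_mem (T.exists_point_row k (by omega))
  have hm0 : m 0 = 0 := Nat.le_zero.1 (hmle T.root_mem)
  have hlt : ∀ k ≤ n, k ≠ 0 → m (m k) < k := by
    intro k hk hk0
    have h1 := hmpt k hk
    refine lt_of_le_of_ne (hmle ((hsymm _ _).1 h1)) fun h2 => ?_
    rcases T.above_xor_left _ _ h1 (by simp [hk0]) with ⟨⟨i, hi, h⟩, -⟩ | ⟨⟨j, hj, h⟩, -⟩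
    · exact absurd (hmle ((hsymm _ _).1 h)) (by omega)
    · exact absurd (hmle h) (by omega)
  have hm : m ∈ fillings w := by
    refine ⟨fun k hk => ?_, fun k hk => ?_⟩
    · rw [mem_labels_labelWord] at hk
      rcases eq_or_ne k 0 with rfl | hk0
      · exact hm0
      · have : {j | (k, j) ∈ T.points} = ∅ := by
          ext j
          simp only [Set.mem_ofPred_eq, Set.mem_empty_iff_false, iff_false]
          intro h
          have := hle _ _ (hmem h)
          omega
        simp only [m, this, Nat.sInf_empty]
    · rw [mem_labels_labelWord] at hk
      have hkn : k ≤ n := by omega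
      refine ⟨or_iff_not_imp_left.2 fun h => ?_, hlt k hkn (by omega)⟩
      have h1 : (k, m k) ∈ borderDiagram w := hdiag ▸ hmem (hmpt k hkn)
      rw [mem_borderDiagram_of_pos (by omega) h] at h1
      exact ⟨(mem_labels_of_diagramRel h1).2, h1⟩
  have hpoints : ∀ i j, (i, j) ∈ T.points ↔ (i < n + 1 ∧ j < n + 1) ∧ (m i = j ∨ m j = i) := by
    intro i j
    constructor
    · intro h
      refine ⟨⟨hle _ _ (hmem h), hle _ _ (hS _ _ (hmem h))⟩, ?_⟩
      by_cases h0 : (i, j) = (0, 0)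
      · simp only [Prod.mk.injEq] at h0
        simp [h0, hm0]
      have h1 := hle _ _ (hmem h)
      have h2 := hle _ _ (hS _ _ (hmem h))
      rcases T.above_xor_left _ _ h h0 with ⟨-, h3⟩ | ⟨-, h3⟩
      · refine Or.inl (le_antisymm (hmle h) (not_lt.1 fun h4 => h3 ⟨_, h4, hmpt i (by omega)⟩))
      · refine Or.inr (le_antisymm (hmle ((hsymm _ _).1 h))
          (not_lt.1 fun h4 => h3 ⟨_, h4, (hsymm _ _).1 (hmpt j (by omega))⟩))
    · rintro ⟨⟨hi, hj⟩, rfl | rfl⟩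
      · exact hmpt i (by omega)
      · exact (hsymm _ _).1 (hmpt j (by omega))
  refine ⟨w, hw, m, hm, Subtype.ext ?_⟩
  have hP : (tableauOfFilling hw hm).1.points = T.points := by
    ext ⟨i, j⟩
    simp only [tableauOfFilling, Finset.mem_filter, Finset.mem_product, Finset.mem_range, hpoints]
  have hQ : (tableauOfFilling hw hm).1.shape = T.shape := hdiag
  generalize (tableauOfFilling hw hm).1 = U at hP hQ
  cases T
  cases U
  simp_all

/-! ### Summation over border words -/

/-- The words of length `n`. -/
def words : ℕ → Finset (List Bool)
  | 0 => {[]}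
  | n + 1 => (words n).image (List.cons false) ∪ (words n).image (List.cons true)

theorem mem_words {n : ℕ} {w : List Bool} : w ∈ words n ↔ w.length = n := by
  induction n generalizing w with
  | zero => simp [words]
  | succ n ih =>
    obtain _ | ⟨c, w⟩ := w
    · simp [words]
    · cases c <;> simp [words, ih]

theorem sum_words_succ {R : Type*} [AddCommMonoid R] (n : ℕ) (f : List Bool → R) :
    ∑ w ∈ words (n + 1), f w = ∑ w ∈ words n, f (false :: w) + ∑ w ∈ words n, f (true :: w) := by
  rw [words, Finset.sum_union, Finset.sum_image (by simp), Finset.sum_image (by simp)]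
  rw [Finset.disjoint_left]
  simp

/-- A sum over the symmetric tableaux of a function of the number of diagonal boxes is a sum over
border words, weighted by the numbers of fillings. -/
theorem sum_symmetricTreeLikeTableau {R : Type*} [CommRing R] (n : ℕ)
    [Fintype (SymmetricTreeLikeTableau (2 * n + 1))] (f : ℕ → R) :
    ∑ T : SymmetricTreeLikeTableau (2 * n + 1), f T.1.numDiagonalBoxes =
      ∑ w ∈ words n, (wordValue 1 w : R) * f (w.count true + 1) := by
  have h (w : List Bool) : (wordValue 1 w : R) * f (w.count true + 1) =
      ∑ m ∈ (finite_parentMaps (labels (labelWord 1 w)) (diagramRel (labelWord 1 w))).toFinset,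
        f (w.count true + 1) := by
    have := ncard_parentMaps_diagramRel (labelWord 1 w) (compatible_labelWord 1 w)
      (zero_notMem_labels_labelWord w)
    rw [map_snd_labelWord, Set.ncard_eq_toFinset_card _ (finite_parentMaps _ _)] at this
    rw [Finset.sum_const, ← this, nsmul_eq_mul, Int.cast_natCast]
  simp_rw [h]
  rw [Finset.sum_sigma']
  symm
  refine Finset.sum_bij (fun p hp => tableauOfFilling (n := n) (w := p.1) (m := p.2)
    (mem_words.1 (Finset.mem_sigma.1 hp).1)
    ((Set.Finite.mem_toFinset _).1 (Finset.mem_sigma.1 hp).2)) ?_ ?_ ?_ ?_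
  · exact fun _ _ => Finset.mem_univ _
  · rintro ⟨w, m⟩ hp ⟨w', m'⟩ hp' h
    obtain ⟨rfl, rfl⟩ := tableauOfFilling_injective _ _ _ _ h
    rfl
  · intro T _
    obtain ⟨w, hw, m, hm, h⟩ := exists_tableauOfFilling T
    refine ⟨⟨w, m⟩, ?_, h⟩
    rw [Finset.mem_sigma, Set.Finite.mem_toFinset]
    exact ⟨mem_words.2 hw, hm⟩
  · rintro ⟨w, m⟩ hp
    exact congrArg f (card_diagonal_borderDiagram w).symm

/-! ### The generating polynomial of the number of diagonal boxes -/

/-- The generating polynomial, evaluated at `x`, of the values of the words of length `n` in the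
state `k`, by the number of horizontal steps. -/
noncomputable def wordSum (x : ℂ) (n k : ℕ) : ℂ :=
  ∑ w ∈ words n, (wordValue k w : ℂ) * x ^ w.count true

theorem wordSum_zero (x : ℂ) (k : ℕ) : wordSum x 0 (k + 1) = 2 ^ k * k.factorial := by
  simp [wordSum, words, wordValue]

theorem wordSum_succ (x : ℂ) (n k : ℕ) :
    wordSum x (n + 1) k = k * (1 - x) * wordSum x n k + x * wordSum x n (k + 1) := by
  simp only [wordSum, sum_words_succ, Finset.mul_sum, ← Finset.sum_add_distrib]
  refine Finset.sum_congr rfl fun w _ => ?_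
  simp [wordValue, pow_succ]
  ring

theorem wordSum_one (n k : ℕ) : wordSum 1 n (k + 1) = 2 ^ (n + k) * (n + k).factorial := by
  induction n generalizing k with
  | zero => simp [wordSum_zero]
  | succ n ih =>
    rw [wordSum_succ, ih (k + 1), sub_self, mul_zero, zero_mul, zero_add, one_mul,
      show n + (k + 1) = n + 1 + k by ring]

/-- The recurrence in the state satisfied by `wordSum` is that of power series with coefficients
`j ^ n * (j + k).choose k`, as `j * (j + k).choose k` is
`(k + 1) * ((j + k + 1).choose (k + 1) - (j + k).choose k)`. -/
theorem hasSum_pow_mul_choose {x : ℂ} (hx0 : x ≠ 0) (hx1 : x ≠ 1)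
    (hx : ‖(1 + x) / (2 * x)‖ < 1) (n k : ℕ) :
    HasSum (fun j : ℕ => (j : ℂ) ^ n * (j + k).choose k * ((1 + x) / (2 * x)) ^ j)
      (wordSum x n (k + 1) * (2 * x ^ (k + 1) / ((x - 1) ^ (n + k + 1) * k.factorial))) := by
  have hx1' : x - 1 ≠ 0 := sub_ne_zero.2 hx1
  induction n generalizing k with
  | zero =>
    have h := hasSum_choose_mul_geometric_of_norm_lt_one k hx
    have e : 1 - (1 + x) / (2 * x) = (x - 1) / (2 * x) := by
      field_simp
      ring
    rw [e] at h
    have hk : (k.factorial : ℂ) ≠ 0 := by exact_mod_cast k.factorial_ne_zero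
    convert! h using 1
    · simp
    · rw [wordSum_zero, div_pow, one_div_div, zero_add]
      field_simp
      ring
  | succ n ih =>
    have h := ((ih (k + 1)).sub (ih k)).mul_left ((k : ℂ) + 1)
    have hk : (k.factorial : ℂ) ≠ 0 := by exact_mod_cast k.factorial_ne_zero
    have hk' : (k : ℂ) + 1 ≠ 0 := by exact_mod_cast k.succ_ne_zero
    convert! h using 1
    · ext j
      have hc : ((j : ℂ) + k + 1) * (j + k).choose k = (j + (k + 1)).choose (k + 1) * (k + 1) := by
        exact_mod_cast Nat.add_one_mul_choose_eq (j + k) k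
      rw [← sub_eq_zero]
      linear_combination (j : ℂ) ^ n * ((1 + x) / (2 * x)) ^ j * hc
    · rw [wordSum_succ, Nat.factorial_succ]
      push_cast
      field_simp
      ring

/-! ### Expansion into poles -/

open Complex in
/-- The base of the `(n + 1)`-st power that a logarithm of `exp (-φ * I) * cos φ`, indexed by `d`,
contributes to the characteristic function of the number of diagonal boxes at `2 * φ`. The factor
`exp (-(φ / 2) * I)` takes the centring at `3 * (n + 1) / 4` into account. -/
noncomputable def poleTerm (φ : ℝ) (d : ℤ) : ℂ :=
  exp (-(φ / 2) * I) * Real.sin φ / (φ + Real.log (Real.cos φ) * I - 2 * Real.pi * d)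

theorem sin_ne_zero_of_abs_le_one {φ : ℝ} (h0 : φ ≠ 0) (h1 : |φ| ≤ 1) : Real.sin φ ≠ 0 := by
  rw [abs_le] at h1
  have := Real.pi_gt_three
  exact fun h => h0 ((Real.sin_eq_zero_iff_of_lt_of_lt (by linarith) (by linarith)).1 h)

theorem cos_mem_Ioo_of_abs_le_one {φ : ℝ} (h0 : φ ≠ 0) (h1 : |φ| ≤ 1) :
    0 < Real.cos φ ∧ Real.cos φ < 1 := by
  refine ⟨Real.cos_pos_of_le_one h1, lt_of_le_of_ne (Real.cos_le_one φ) fun h => ?_⟩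
  have := Real.sin_sq_add_cos_sq φ
  rw [h] at this
  exact sin_ne_zero_of_abs_le_one h0 h1 (by nlinarith)

open Complex in
/-- The power series `∑ j, j ^ n * w ^ j`, where `w = exp (-φ * I) * cos φ`, is a sum over the
solutions of `exp s = w`, by Lipschitz's formula. -/
theorem wordSum_eq_tsum_poleTerm {φ : ℝ} (h0 : φ ≠ 0) (h1 : |φ| ≤ 1) {n : ℕ} (hn : 1 ≤ n) :
    exp (-(3 / 2 * φ) * I) ^ (n + 1) *
        (exp (2 * φ * I) * wordSum (exp (2 * φ * I)) n 1) / (2 ^ n * n.factorial) =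
      ∑' d : ℤ, poleTerm φ d ^ (n + 1) := by
  set x : ℂ := exp (2 * φ * I) with hx
  obtain ⟨hc0, hc1⟩ := cos_mem_Ioo_of_abs_le_one h0 h1
  have hs := sin_ne_zero_of_abs_le_one h0 h1
  have hxe : x = exp (φ * I) ^ 2 := by rw [hx, ← Complex.exp_nat_mul]; push_cast; ring_nf
  have hinv : exp (-φ * I) * exp (φ * I) = 1 := by rw [← Complex.exp_add]; simp
  have hx0 : x ≠ 0 := Complex.exp_ne_zero _
  have hsin : x - 1 = exp (φ * I) * (2 * I * Real.sin φ) := by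
    rw [hxe, Complex.ofReal_sin, Complex.sin]
    linear_combination hinv - (exp (φ * I) * exp (-φ * I) - exp (φ * I) ^ 2) * I_sq
  have hx1 : x ≠ 1 := by
    rw [← sub_ne_zero, hsin]
    simp [Complex.exp_ne_zero, hs, -Complex.ofReal_sin]
  have hw : (1 + x) / (2 * x) = exp (-φ * I) * Real.cos φ := by
    rw [div_eq_iff (by simpa using hx0), hxe, Complex.ofReal_cos, Complex.cos]
    linear_combination (-(exp (φ * I) ^ 2) - exp (-φ * I) * exp (φ * I) - 1) * hinv
  have hwn : ‖(1 + x) / (2 * x)‖ < 1 := by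
    rw [hw, norm_mul, ← Complex.ofReal_neg, Complex.norm_exp_ofReal_mul_I, one_mul,
      Complex.norm_real, Real.norm_eq_abs, abs_of_pos hc0]
    exact hc1
  have hsum := (hasSum_pow_mul_choose hx0 hx1 hwn n 0).tsum_eq
  -- The point `z` of the upper half plane with `exp (2 * π * I * z) = (1 + x) / (2 * x)`.
  let z : UpperHalfPlane := ⟨(-φ - Real.log (Real.cos φ) * I) / (2 * Real.pi), by
    have : ((-φ - Real.log (Real.cos φ) * I) / (2 * Real.pi) : ℂ).im =
        -Real.log (Real.cos φ) / (2 * Real.pi) := by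
      rw [show (2 * Real.pi : ℂ) = ((2 * Real.pi : ℝ) : ℂ) by push_cast; rfl,
        Complex.div_ofReal_im]
      simp
    rw [this]
    have := Real.log_neg hc0 hc1
    have := Real.pi_pos
    exact div_pos (by linarith) (by linarith)⟩
  have hpi : (Real.pi : ℂ) ≠ 0 := by exact_mod_cast Real.pi_ne_zero
  have hz : (z : ℂ) = (-φ - Real.log (Real.cos φ) * I) / (2 * Real.pi) := rfl
  have hexp : exp (2 * Real.pi * I * z) = (1 + x) / (2 * x) := by
    rw [hw, hz, show 2 * Real.pi * I * ((-φ - Real.log (Real.cos φ) * I) / (2 * Real.pi)) =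
      -φ * I + Real.log (Real.cos φ) by
        field_simp
        linear_combination (-Real.log (Real.cos φ) : ℂ) * I_sq, Complex.exp_add,
      ← Complex.ofReal_exp, Real.exp_log hc0]
  have hlip := EisensteinSeries.qExpansion_identity hn z
  rw [hexp] at hlip
  have hnf : (n.factorial : ℂ) ≠ 0 := by exact_mod_cast n.factorial_ne_zero
  have hx1' : x - 1 ≠ 0 := sub_ne_zero.2 hx1
  simp only [Nat.add_zero, Nat.choose_zero_right, Nat.cast_one, mul_one, Nat.factorial_zero,
    zero_add, pow_one] at hsum
  rw [hsum] at hlip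
  have hterm (d : ℤ) : poleTerm φ d ^ (n + 1) =
      (exp (-(φ / 2) * I) * Real.sin φ / (-2 * Real.pi)) ^ (n + 1) *
        (1 / ((z : ℂ) + d) ^ (n + 1)) := by
    have : (z : ℂ) + d =
        (φ + Real.log (Real.cos φ) * I - 2 * Real.pi * d) / (-2 * Real.pi) := by
      rw [hz]
      field_simp
      ring
    rw [one_div, ← inv_pow, ← mul_pow, poleTerm, this, inv_div,
      div_mul_div_cancel₀ (by simp)]
  have key : exp (-(φ / 2) * I) * Real.sin φ / (-2 * Real.pi) * (-2 * Real.pi * I) / (x - 1) =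
      exp (-(3 / 2 * φ) * I) / 2 := by
    have hs' : (Real.sin φ : ℂ) ≠ 0 := by exact_mod_cast hs
    have : exp (-(φ / 2) * I) = exp (-(3 / 2 * φ) * I) * exp (φ * I) := by
      rw [← Complex.exp_add]
      ring_nf
    have := Complex.exp_ne_zero (φ * I)
    rw [hsin, ‹exp (-(φ / 2) * I) = _›]
    field_simp
  simp_rw [hterm]
  rw [tsum_mul_left, hlip]
  calc _ = (exp (-(3 / 2 * φ) * I) / 2) ^ (n + 1) * (2 * x * wordSum x n 1 / n.factorial) := by
        rw [div_pow]
        field_simp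
        ring
    _ = _ := by
        rw [← key]
        simp only [div_pow, mul_pow]
        field_simp

/-- All the poles but the one of index `0` have a negligible contribution. -/
theorem norm_tsum_poleTerm_sub_le {φ : ℝ} (h1 : |φ| ≤ 1) {n : ℕ} (hn : 1 ≤ n) :
    ‖∑' d : ℤ, poleTerm φ d ^ (n + 1) - poleTerm φ 0 ^ (n + 1)‖ ≤
      φ ^ 2 * ∑' d : ℤ, 1 / (d : ℝ) ^ 2 := by
  have hbound (d : ℤ) (hd : d ≠ 0) : ‖poleTerm φ d ^ (n + 1)‖ ≤ φ ^ 2 * (1 / (d : ℝ) ^ 2) := by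
    have hd1 : (1 : ℝ) ≤ |(d : ℝ)| := by exact_mod_cast Int.one_le_abs hd
    have hden : |(d : ℝ)| ≤
        ‖(φ + Real.log (Real.cos φ) * Complex.I - 2 * Real.pi * d : ℂ)‖ := by
      refine le_trans ?_ (Complex.abs_re_le_norm _)
      have : (φ + Real.log (Real.cos φ) * Complex.I - 2 * Real.pi * d : ℂ).re =
          φ - 2 * Real.pi * d := by simp
      rw [this]
      have h2 : |2 * Real.pi * d| - |φ| ≤ |φ - 2 * Real.pi * d| := by
        rw [abs_sub_comm]
        exact abs_sub_abs_le_abs_sub _ _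
      rw [abs_mul, abs_of_pos (by positivity)] at h2
      have := Real.pi_gt_three
      nlinarith
    have hle : ‖poleTerm φ d‖ ≤ |φ| / |(d : ℝ)| := by
      rw [poleTerm, norm_div, norm_mul, Complex.norm_real, Real.norm_eq_abs,
        show (-(φ / 2) * Complex.I : ℂ) = ((-(φ / 2) : ℝ) : ℂ) * Complex.I by push_cast; rfl,
        Complex.norm_exp_ofReal_mul_I, one_mul]
      exact div_le_div₀ (abs_nonneg _) Real.abs_sin_le_abs (by linarith) hden
    have hle1 : ‖poleTerm φ d‖ ≤ 1 := hle.trans (div_le_one_of_le₀ (by linarith) (abs_nonneg _))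
    rw [norm_pow]
    calc ‖poleTerm φ d‖ ^ (n + 1) ≤ ‖poleTerm φ d‖ ^ 2 :=
          pow_le_pow_of_le_one (norm_nonneg _) hle1 (by omega)
      _ ≤ (|φ| / |(d : ℝ)|) ^ 2 := pow_le_pow_left₀ (norm_nonneg _) hle 2
      _ = φ ^ 2 * (1 / (d : ℝ) ^ 2) := by
          rw [div_pow, sq_abs, sq_abs]
          ring
  have hsum : Summable fun d : ℤ => φ ^ 2 * (1 / (d : ℝ) ^ 2) :=
    (Real.summable_one_div_int_pow.2 one_lt_two).mul_left _
  have hite (d : ℤ) : ‖if d = 0 then 0 else poleTerm φ d ^ (n + 1)‖ ≤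
      φ ^ 2 * (1 / (d : ℝ) ^ 2) := by
    split_ifs with h
    · rw [norm_zero]
      positivity
    · exact hbound d h
  have hpole : Summable fun d : ℤ => poleTerm φ d ^ (n + 1) := by
    refine Summable.of_norm_bounded_eventually hsum ?_
    filter_upwards [(Set.finite_singleton (0 : ℤ)).compl_mem_cofinite] with d hd
    exact hbound d hd
  rw [hpole.tsum_eq_add_tsum_ite 0, add_sub_cancel_left, ← tsum_mul_left]
  exact (norm_tsum_le_tsum_norm (Summable.of_nonneg_of_le (fun _ => norm_nonneg _) hite hsum)).trans
    (Summable.tsum_le_tsum hite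
      (Summable.of_nonneg_of_le (fun _ => norm_nonneg _) hite hsum) hsum)

/-! ### The dominant pole -/

/-- Together with `abs_sin_sin_add_log_cos_le`, this is the third order expansion of
`exp (-(φ / 2) * I) * sin φ - (φ + log (cos φ) * I)`, split into real and imaginary parts. -/
theorem abs_cos_sin_sub_le {φ : ℝ} (h : |φ| ≤ 1 / 2) :
    |Real.cos (φ / 2) * Real.sin φ - φ + 7 / 24 * φ ^ 3| ≤ |φ| ^ 4 := by
  have e1 : |3 / 2 * φ| = 3 / 2 * |φ| := by rw [abs_mul]; norm_num
  have e2 : |φ / 2| = |φ| / 2 := by rw [abs_div]; norm_num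
  have h1 := Real.sin_bound (x := 3 / 2 * φ) (by rw [e1]; linarith)
  have h2 := Real.sin_bound (x := φ / 2) (by rw [e2]; linarith)
  have e : Real.cos (φ / 2) * Real.sin φ =
      (Real.sin (3 / 2 * φ) + Real.sin (φ / 2)) / 2 := by
    rw [show 3 / 2 * φ = φ + φ / 2 by ring, show Real.sin (φ / 2) = Real.sin (φ - φ / 2) by ring_nf,
      Real.sin_add, Real.sin_sub]
    ring
  rw [e1] at h1
  rw [e2] at h2
  have h3 : |φ| ^ 5 ≤ |φ| ^ 4 :=
    pow_le_pow_of_le_one (abs_nonneg _) (by linarith) (by norm_num)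
  have h4 : 0 ≤ |φ| ^ 5 := by positivity
  rw [e]
  rw [abs_le] at h1 h2 ⊢
  constructor <;> nlinarith

theorem abs_log_cos_le {φ : ℝ} (h : |φ| ≤ 1 / 2) :
    |Real.log (Real.cos φ) + φ ^ 2 / 2| ≤ |φ| ^ 4 := by
  have h1 := Real.cos_bound (x := φ) (by linarith)
  set y := 1 - Real.cos φ with hy
  have hy0 : 0 ≤ y := by linarith [Real.cos_le_one φ]
  have hy1 : y ≤ φ ^ 2 / 2 := by linarith [Real.one_sub_sq_div_two_le_cos (x := φ)]
  have hsq : φ ^ 2 ≤ 1 / 4 := by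
    rw [← sq_abs]
    nlinarith [abs_nonneg φ]
  have h2 := Real.abs_log_sub_add_sum_range_le (x := y) (by rw [abs_of_nonneg hy0]; linarith) 1
  have h3 : |y| ^ (1 + 1) / (1 - |y|) ≤ |φ| ^ 4 * (1 / 2) := by
    rw [abs_of_nonneg hy0, div_le_iff₀ (by linarith)]
    have : |φ| ^ 4 = (φ ^ 2) ^ 2 := by rw [← sq_abs φ]; ring
    rw [this]
    have : y ^ 2 ≤ (φ ^ 2 / 2) ^ 2 := pow_le_pow_left₀ hy0 hy1 2
    nlinarith [sq_nonneg (φ ^ 2)]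
  have h4 := h2.trans h3
  have h5 : 0 ≤ |φ| ^ 4 := by positivity
  simp only [Finset.sum_range_one, zero_add, pow_one, Nat.cast_zero, div_one] at h4
  rw [show 1 - y = Real.cos φ by rw [hy]; ring] at h4
  rw [abs_le] at h1 h4 ⊢
  constructor <;> linarith

theorem abs_sin_sin_add_log_cos_le {φ : ℝ} (h : |φ| ≤ 1 / 2) :
    |Real.sin (φ / 2) * Real.sin φ + Real.log (Real.cos φ)| ≤ 2 * |φ| ^ 4 := by
  have e1 : |3 / 2 * φ| = 3 / 2 * |φ| := by rw [abs_mul]; norm_num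
  have e2 : |φ / 2| = |φ| / 2 := by rw [abs_div]; norm_num
  have h1 := Real.cos_bound (x := 3 / 2 * φ) (by rw [e1]; linarith)
  have h2 := Real.cos_bound (x := φ / 2) (by rw [e2]; linarith)
  have h3 := abs_log_cos_le h
  have e : Real.sin (φ / 2) * Real.sin φ =
      (Real.cos (φ / 2) - Real.cos (3 / 2 * φ)) / 2 := by
    rw [show 3 / 2 * φ = φ + φ / 2 by ring, show Real.cos (φ / 2) = Real.cos (φ - φ / 2) by ring_nf,
      Real.cos_add, Real.cos_sub]
    ring
  rw [e1] at h1
  rw [e2] at h2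
  have h5 : 0 ≤ |φ| ^ 4 := by positivity
  rw [e]
  rw [abs_le] at h1 h2 h3 ⊢
  constructor <;> nlinarith

open Complex in
/-- The second order expansion of the dominant term, giving the variance. -/
theorem tendsto_poleTerm_zero_sub_one :
    Tendsto (fun φ : ℝ => (poleTerm φ 0 - 1) / (φ : ℂ) ^ 2) (nhdsWithin 0 {0}ᶜ)
      (nhds (-7 / 24)) := by
  have hball : ∀ᶠ φ : ℝ in nhdsWithin 0 {0}ᶜ, φ ≠ 0 ∧ |φ| ≤ 1 / 2 := by
    refine (eventually_mem_nhdsWithin).and (nhdsWithin_le_nhds ?_)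
    filter_upwards [Metric.closedBall_mem_nhds (0 : ℝ) (by norm_num : (0 : ℝ) < 1 / 2)] with φ hφ
    simpa using hφ
  have hcont : Tendsto (fun φ : ℝ => 3 * |φ|) (nhdsWithin 0 {0}ᶜ) (nhds 0) := by
    refine tendsto_nhdsWithin_of_tendsto_nhds ?_
    have : Continuous fun φ : ℝ => 3 * |φ| := by fun_prop
    simpa using this.tendsto 0
  have hnum : Tendsto (fun φ : ℝ => (exp (-(φ / 2) * I) * Real.sin φ -
      (φ + Real.log (Real.cos φ) * I)) / (φ : ℂ) ^ 3) (nhdsWithin 0 {0}ᶜ) (nhds (-7 / 24)) := by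
    rw [tendsto_iff_norm_sub_tendsto_zero]
    refine squeeze_zero' (Eventually.of_forall fun _ => norm_nonneg _) ?_ hcont
    filter_upwards [hball] with φ ⟨h0, h1⟩
    have h0' : (φ : ℂ) ≠ 0 := by exact_mod_cast h0
    have e : (exp (-(φ / 2) * I) * Real.sin φ - (φ + Real.log (Real.cos φ) * I)) / (φ : ℂ) ^ 3 -
        (-7 / 24) = (((Real.cos (φ / 2) * Real.sin φ - φ + 7 / 24 * φ ^ 3 : ℝ) : ℂ) -
          ((Real.sin (φ / 2) * Real.sin φ + Real.log (Real.cos φ) : ℝ) : ℂ) * I) /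
            (φ : ℂ) ^ 3 := by
      have : exp (-(φ / 2) * I) = (Real.cos (φ / 2) : ℝ) - (Real.sin (φ / 2) : ℝ) * I := by
        rw [Complex.exp_mul_I, Complex.cos_neg, Complex.sin_neg]
        push_cast
        ring
      rw [this]
      field_simp
      push_cast
      ring
    rw [e, norm_div, norm_pow, Complex.norm_real, Real.norm_eq_abs,
      div_le_iff₀ (pow_pos (abs_pos.2 h0) 3)]
    calc _ ≤ |φ| ^ 4 + 2 * |φ| ^ 4 := by
          refine (norm_sub_le _ _).trans (add_le_add ?_ ?_)
          · rw [Complex.norm_real]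
            exact abs_cos_sin_sub_le h1
          · rw [norm_mul, Complex.norm_I, mul_one, Complex.norm_real]
            exact abs_sin_sin_add_log_cos_le h1
      _ = 3 * |φ| * |φ| ^ 3 := by ring
  have hden : Tendsto (fun φ : ℝ => (φ + Real.log (Real.cos φ) * I : ℂ) / φ)
      (nhdsWithin 0 {0}ᶜ) (nhds 1) := by
    rw [tendsto_iff_norm_sub_tendsto_zero]
    refine squeeze_zero' (Eventually.of_forall fun _ => norm_nonneg _) ?_ hcont
    filter_upwards [hball] with φ ⟨h0, h1⟩
    have h0' : (φ : ℂ) ≠ 0 := by exact_mod_cast h0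
    have e : (φ + Real.log (Real.cos φ) * I : ℂ) / φ - 1 = Real.log (Real.cos φ) * I / φ := by
      field_simp
      ring
    rw [e, norm_div, norm_mul, Complex.norm_I, mul_one, Complex.norm_real, Complex.norm_real,
      Real.norm_eq_abs, Real.norm_eq_abs, div_le_iff₀ (abs_pos.2 h0)]
    have h2 := abs_log_cos_le h1
    have h3 : |φ| ^ 4 ≤ |φ| ^ 2 :=
      pow_le_pow_of_le_one (abs_nonneg _) (by linarith) (by norm_num)
    rw [← sq_abs φ] at h2
    have := sq_nonneg |φ|
    rw [abs_le] at h2 ⊢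
    constructor <;> nlinarith
  have hlim := hnum.div hden one_ne_zero
  rw [div_one] at hlim
  refine hlim.congr' ?_
  filter_upwards [hball, hden.eventually_ne one_ne_zero] with φ ⟨h0, h1⟩ h2
  have h0' : (φ : ℂ) ≠ 0 := by exact_mod_cast h0
  have h3 : (φ + Real.log (Real.cos φ) * I : ℂ) ≠ 0 := fun h => h2 (by rw [h, zero_div])
  simp only [Pi.div_apply, poleTerm, Int.cast_zero, mul_zero, sub_zero]
  rw [div_sub_one h3]
  generalize (φ + Real.log (Real.cos φ) * I : ℂ) = D at h3 ⊢
  field_simp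

/-! ### Convergence of the characteristic functions -/

theorem integral_uniformOn_univ {Ω : Type*} [Fintype Ω] [MeasurableSpace Ω]
    [DiscreteMeasurableSpace Ω] (f : Ω → ℂ) :
    ∫ ω, f ω ∂uniformOn (Set.univ : Set Ω) = (∑ ω, f ω) / Fintype.card Ω := by
  rw [uniformOn, ProbabilityTheory.cond, Measure.restrict_univ, integral_smul_measure,
    integral_count, Measure.count_apply_finite _ Set.finite_univ]
  simp [div_eq_inv_mul]

open Complex in
/-- The characteristic function of the number of diagonal boxes, centred at `a` and scaled by `s`;
`2 ^ n * n!` is the number of symmetric tableaux. -/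
theorem charFun_numDiagonalBoxes (n : ℕ) (a s t : ℝ) :
    charFun ((uniformOn (Set.univ : Set (SymmetricTreeLikeTableau (2 * n + 1)))).map
      fun T => ((T.1.numDiagonalBoxes : ℝ) - a) / s) t =
      exp (-(t / s * a) * I) * (exp (t / s * I) * wordSum (exp (t / s * I)) n 1) /
        (2 ^ n * n.factorial) := by
  have : DiscreteMeasurableSpace (SymmetricTreeLikeTableau (2 * n + 1)) := ⟨fun _ => trivial⟩
  have := Fintype.ofFinite (SymmetricTreeLikeTableau (2 * n + 1))
  have hsum (x : ℂ) : ∑ T : SymmetricTreeLikeTableau (2 * n + 1), x ^ T.1.numDiagonalBoxes =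
      x * wordSum x n 1 := by
    rw [sum_symmetricTreeLikeTableau n fun d => x ^ d, wordSum, Finset.mul_sum]
    exact Finset.sum_congr rfl fun w _ => by ring
  have hcard : (Fintype.card (SymmetricTreeLikeTableau (2 * n + 1)) : ℂ) =
      2 ^ n * n.factorial := by
    have := hsum 1
    rw [wordSum_one] at this
    simpa using this
  rw [charFun_apply_real, integral_map .of_discrete (by fun_prop), integral_uniformOn_univ, hcard,
    ← hsum, Finset.mul_sum]
  congr 1
  refine Finset.sum_congr rfl fun T _ => ?_
  rw [← Complex.exp_nat_mul, ← Complex.exp_add]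
  congr 1
  push_cast
  ring

/-- The half angle at which the generating polynomial is evaluated, for `N = n + 1`. -/
noncomputable def halfAngle (t : ℝ) (N : ℕ) : ℝ := t / √(7 * N / 48) / 2

theorem halfAngle_sq (t : ℝ) {N : ℕ} (h : N ≠ 0) : N * halfAngle t N ^ 2 = 12 / 7 * t ^ 2 := by
  have : (N : ℝ) ≠ 0 := by exact_mod_cast h
  rw [halfAngle, div_pow, div_pow, Real.sq_sqrt (by positivity)]
  field_simp
  ring

theorem tendsto_halfAngle (t : ℝ) : Tendsto (halfAngle t) atTop (nhds 0) := by
  have h : Tendsto (fun N : ℕ => √(7 * N / 48)) atTop atTop := by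
    refine Real.tendsto_sqrt_atTop.comp ?_
    refine Tendsto.atTop_div_const (by norm_num) ?_
    exact tendsto_natCast_atTop_atTop.const_mul_atTop (by norm_num)
  have := (h.const_div_atTop t).div_const 2
  rwa [zero_div] at this

theorem tendsto_poleTerm_zero_pow {t : ℝ} (ht : t ≠ 0) :
    Tendsto (fun N : ℕ => poleTerm (halfAngle t N) 0 ^ N) atTop
      (nhds (Complex.exp (-(t : ℂ) ^ 2 / 2))) := by
  have hne : ∀ᶠ N : ℕ in atTop, halfAngle t N ∈ ({0}ᶜ : Set ℝ) := by
    filter_upwards [eventually_gt_atTop 0] with N hN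
    simp [halfAngle, ht, hN.ne']
  have hlim := tendsto_poleTerm_zero_sub_one.comp
    (tendsto_nhdsWithin_iff.2 ⟨tendsto_halfAngle t, hne⟩)
  have h : Tendsto (fun N : ℕ => (N : ℂ) * (poleTerm (halfAngle t N) 0 - 1)) atTop
      (nhds (-(t : ℂ) ^ 2 / 2)) := by
    have := hlim.const_mul (12 / 7 * (t : ℂ) ^ 2)
    rw [show 12 / 7 * (t : ℂ) ^ 2 * (-7 / 24) = -(t : ℂ) ^ 2 / 2 by ring] at this
    refine this.congr' ?_
    filter_upwards [hne, eventually_gt_atTop 0] with N h0 hN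
    have h2 : (12 / 7 * (t : ℂ) ^ 2) = N * (halfAngle t N : ℂ) ^ 2 := by
      have h1 := congrArg (fun r : ℝ => (r : ℂ)) (halfAngle_sq t hN.ne')
      push_cast at h1
      exact h1.symm
    have h3 : (halfAngle t N : ℂ) ≠ 0 := by exact_mod_cast h0
    rw [h2, Function.comp_apply]
    field_simp
  have := Complex.tendsto_one_add_pow_exp_of_tendsto h
  simpa using this

theorem tendsto_tsum_poleTerm {t : ℝ} (ht : t ≠ 0) :
    Tendsto (fun n : ℕ => ∑' d : ℤ, poleTerm (halfAngle t (n + 1)) d ^ (n + 1)) atTop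
      (nhds (Complex.exp (-(t : ℂ) ^ 2 / 2))) := by
  have hα : Tendsto (fun n : ℕ => halfAngle t (n + 1)) atTop (nhds 0) :=
    (tendsto_halfAngle t).comp (tendsto_add_atTop_nat 1)
  have hmain := (tendsto_poleTerm_zero_pow ht).comp (tendsto_add_atTop_nat 1)
  have herr : Tendsto (fun n : ℕ => ∑' d : ℤ, poleTerm (halfAngle t (n + 1)) d ^ (n + 1) -
      poleTerm (halfAngle t (n + 1)) 0 ^ (n + 1)) atTop (nhds 0) := by
    refine squeeze_zero_norm' ?_ (a := fun n : ℕ => halfAngle t (n + 1) ^ 2 *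
      ∑' d : ℤ, 1 / (d : ℝ) ^ 2) ?_
    · filter_upwards [eventually_ge_atTop 1,
        hα.eventually (Metric.closedBall_mem_nhds (0 : ℝ) one_pos)] with n hn h
      exact norm_tsum_poleTerm_sub_le (by simpa using h) hn
    · have := (hα.pow 2).mul_const (∑' d : ℤ, 1 / (d : ℝ) ^ 2)
      rwa [zero_pow two_ne_zero, zero_mul] at this
  have := herr.add hmain
  rw [zero_add] at this
  exact this.congr fun n => sub_add_cancel _ _

theorem mainTheorem1 :
    TendstoInDistribution
      (fun (n : ℕ) (T : SymmetricTreeLikeTableau (2 * n + 1)) =>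
        ((T.1.numDiagonalBoxes : ℝ) - 3 * ((n : ℝ) + 1) / 4) / √(7 * ((n : ℝ) + 1) / 48))
      atTop (fun x : ℝ => x)
      (fun n : ℕ => uniformOn (Set.univ : Set (SymmetricTreeLikeTableau (2 * n + 1))))
      (gaussianReal 0 1) := by
  have hd (n : ℕ) : DiscreteMeasurableSpace (SymmetricTreeLikeTableau (2 * n + 1)) :=
    ⟨fun _ => trivial⟩
  refine ⟨fun n => .of_discrete, by fun_prop, ?_⟩
  refine ProbabilityMeasure.tendsto_iff_tendsto_charFun.2 fun t => ?_
  simp only [ProbabilityMeasure.coe_mk, Measure.map_id', charFun_gaussianReal,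
    charFun_numDiagonalBoxes]
  rcases eq_or_ne t 0 with rfl | ht
  · have hn (n : ℕ) : (2 ^ n * n.factorial : ℂ) ≠ 0 := by
      exact_mod_cast (by positivity : 2 ^ n * n.factorial ≠ 0)
    simp [wordSum_one, hn]
  · have hexp : Complex.exp (t * (0 : ℝ) * Complex.I - (1 : NNReal) * t ^ 2 / 2) =
        Complex.exp (-(t : ℂ) ^ 2 / 2) := by
      congr 1
      push_cast
      ring
    rw [hexp]
    refine (tendsto_tsum_poleTerm ht).congr' ?_
    have hα : Tendsto (fun n : ℕ => halfAngle t (n + 1)) atTop (nhds 0) :=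
      (tendsto_halfAngle t).comp (tendsto_add_atTop_nat 1)
    filter_upwards [eventually_ge_atTop 1,
      hα.eventually (Metric.closedBall_mem_nhds (0 : ℝ) one_pos)] with n hn h
    have hN : (0 : ℝ) < n + 1 := by positivity
    have h0 : halfAngle t (n + 1) ≠ 0 := by
      have : √(7 * ((n + 1 : ℕ) : ℝ) / 48) ≠ 0 := (Real.sqrt_pos.2 (by positivity)).ne'
      simp only [halfAngle]
      positivity
    rw [← wordSum_eq_tsum_poleTerm h0 (by simpa using h) hn]
    have e : ((t : ℂ) / (√(7 * ((n : ℝ) + 1) / 48) : ℝ)) = 2 * (halfAngle t (n + 1) : ℝ) := by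
      rw [halfAngle]
      push_cast
      ring
    rw [e, ← Complex.exp_nat_mul]
    congr 3
    push_cast
    ring
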